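/- Let $H=(h_{ji})_{j\in J,\,i\in I}$ be a parity-check matrix over $\mathbb F_2$ with finite index sets $J$ (checks) and $I=\{1,\dots,n\}$ (bits), defining the binary code $C=\{x\in\mathbb F_2^n : Hx=0\}$. Its Tanner graph $T$ is the bipartite graph on $I\sqcup J$ in which the bit node $i$ and the check node $j$ are adjacent iff $h_{ji}=1$. Assume that $C$ is a cycle code, i.e. every bit node has degree $2$ in $T$. The normal graph $N=N(H)$ has vertex set $J$ and edges $e_1,\dots,e_n$, where $e_i$ joins the two checks adjacent to bit $i$ (parallel edges may occur). A cycle in $N$ is a nonempty sequence $\Gamma=(e_{i_1},\dots,e_{i_k})$ of edges, each with a direction, such that each edge ends where the next one begins and the last one ends where the first one begins. It is backtrackless if $e_{i_s}\ne e_{i_{s+1}}$ for all $1\le s<k$, tailless if $e_{i_1}\ne e_{i_k}$, and primitive if it is not the $r$-fold repetition of a cycle for any $r\ge 2$. Two cycles are equivalent if they differ by a cyclic shift. Put $g(\Gamma)=u_{i_1}\cdots u_{i_k}$. Hashimoto's edge zeta function of $N$ is $$\zeta_N(u_1,\dots,u_n)=\prod_{[\Gamma]}\bigl(1-g(\Gamma)\bigr)^{-1}\in\mathbb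 Z[[u_1,\dots,u_n]],$$ the product running over the equivalence classes of backtrackless, tailless, primitive cycles in $N$. For a positive integer $M$, an $M$-cover of $T$ is a graph $\widetilde T$ with a surjective graph homomorphism $\pi:\widetilde T\to T$ that maps the neighbourhood of each vertex $y$ bijectively onto the neighbourhood of $\pi(y)$ and whose fibres all have exactly $M$ elements. A codeword of $\widetilde T$ is an assignment $\tilde c$ of values in $\mathbb F_2$ to the vertices over bit nodes such that for each vertex over a check node the values at its neighbours sum to $0$. Its pseudo-codeword is $\omega(\tilde c)\in\mathbb Q^n$ with $\omega_i(\tilde c)=\frac1M\sum_{b\in\pi^{-1}(i)}\tilde c_b$ (values $0,1$ summed in $\mathbb Q$), and $M\cdot\omega(\tilde c)$ is called an unscaled pseudo-codeword of $C$. Theorem. The infinite product defining $\zeta_N$ converges coefficientwise (unconditionally), and for every $(p_1,\dots,p_n)\in\mathbb Z_{\ge0}^n$ the monomial $u_1^{p_1}\cdots u_n^{p_n}$ has nonzero coefficient in $\zeta_N$ if and only if $(p_1,\dots,p_n)$ is an unscaled pseudo-codeword of $C$, that is, equals $M\cdot\omega(\tilde c)$ for some $M\ge1$, some $M$-cover of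 $T$ and some codeword $\tilde c$ of that cover. -/

import Mathlib

open scoped MvPowerSeries.WithPiTopology

namespace CycleCode

/-! ### Binary codes, Tanner graphs, cycle codes -/

/-- The binary linear code with parity-check matrix `H` (rows = checks, columns = bits). -/
def binaryCode {J I : Type*} [Fintype I] (H : Matrix J I (ZMod 2)) :
    Submodule (ZMod 2) (I → ZMod 2) :=
  LinearMap.ker H.mulVecLin

/-- The Tanner graph of `H`: bit nodes `Sum.inl i`, check nodes `Sum.inr j`, and an edge
between them exactly when `H j i = 1`. -/
def tannerGraph {J I : Type*} (H : Matrix J I (ZMod 2)) : SimpleGraph (I ⊕ J) where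
  Adj a b := (∃ i j, a = Sum.inl i ∧ b = Sum.inr j ∧ H j i = 1) ∨
    (∃ i j, a = Sum.inr j ∧ b = Sum.inl i ∧ H j i = 1)
  symm := ⟨by
    rintro a b (⟨i, j, h⟩ | ⟨i, j, h⟩)
    · exact Or.inr ⟨i, j, h.2.1, h.1, h.2.2⟩
    · exact Or.inl ⟨i, j, h.2.1, h.1, h.2.2⟩⟩
  loopless := ⟨by
    rintro a (⟨i, j, h, h', -⟩ | ⟨i, j, h, h', -⟩) <;> simp [h] at h'⟩

/-- `H` defines a cycle code: every bit node of the Tanner graph has degree two. -/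
def IsCycleCode {J I : Type*} (H : Matrix J I (ZMod 2)) : Prop :=
  ∀ i : I, ((tannerGraph H).neighborSet (Sum.inl i)).ncard = 2

/-! ### Covers and pseudo-codewords -/

/-- A graph homomorphism `π : Y → X` is an (unramified) `M`-cover: it is surjective, it maps the
neighbourhood of each vertex `y` bijectively onto the neighbourhood of `π y`, and each fibre has
exactly `M` elements. -/
structure IsMCover {V W : Type*} {X : SimpleGraph V} {Y : SimpleGraph W} (π : Y →g X) (M : ℕ) :
    Prop where
  surjective : Function.Surjective π
  bijOn_neighborSet : ∀ y : W, Set.BijOn π (Y.neighborSet y) (X.neighborSet (π y))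
  ncard_fiber : ∀ x : V, (π ⁻¹' {x}).ncard = M

section Cover

variable {J I : Type*} {H : Matrix J I (ZMod 2)} {W : Type*} {Y : SimpleGraph W}

/-- The bit nodes of a cover of a Tanner graph: the vertices lying over bit nodes. -/
abbrev BitNode (π : Y →g tannerGraph H) : Type _ := {w : W // (π w).isLeft = true}

/-- The check nodes of a cover of a Tanner graph: the vertices lying over check nodes. -/
abbrev CheckNode (π : Y →g tannerGraph H) : Type _ := {w : W // (π w).isRight = true}

open Classical in
/-- The parity-check matrix described by a cover of a Tanner graph. -/
noncomputable def coverMatrix (π : Y →g tannerGraph H) :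
    Matrix (CheckNode π) (BitNode π) (ZMod 2) :=
  fun w b => if Y.Adj w b then 1 else 0

open Classical in
/-- The pseudo-codeword `ω(c)` of a configuration `c` of an `M`-cover: `ω_i(c)` is `1 / M` times
the sum, in `ℚ`, of the values in `{0, 1}` of `c` on the copies of the bit node `i`. -/
noncomputable def pseudoCodeword [Fintype W] (π : Y →g tannerGraph H) (M : ℕ)
    (c : BitNode π → ZMod 2) : I → ℚ :=
  fun i => (1 / (M : ℚ)) * ∑ b ∈ (Finset.univ : Finset (BitNode π)).filter (fun b => π b.1 = Sum.inl i),
    ((c b).val : ℚ)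

end Cover

/-- `x` is an unscaled pseudo-codeword: `x = M • ω(c)` for some positive `M`, some `M`-cover of the
Tanner graph and some codeword `c` of the code described by that cover. (Such covers are finite
when the Tanner graph is, so covers with vertex type in `Type` are all covers up to
isomorphism.) -/
def IsUnscaledPseudoCodeword {J I : Type*} (H : Matrix J I (ZMod 2)) (x : I → ℚ) : Prop :=
  ∃ (M : ℕ) (W : Type) (_ : Fintype W) (Y : SimpleGraph W) (π : Y →g tannerGraph H),
    0 < M ∧ IsMCover π M ∧
      ∃ c ∈ binaryCode (coverMatrix π), x = (M : ℚ) • pseudoCodeword π M c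

/-! ### The normal graph -/

/-- The normal graph: its vertices are the checks, and each bit `i` of degree two is an edge
joining the two checks that involve it. -/
def normalGraph {J I : Type*} (H : Matrix J I (ZMod 2)) : Graph J I where
  vertexSet := Set.univ
  IsLink i x y := x ≠ y ∧ {j | H j i = 1} = {x, y}
  isLink_symm := fun _ _ => ⟨fun x y h => ⟨h.1.symm, h.2.trans (Set.pair_comm x y)⟩⟩
  eq_or_eq_of_isLink_of_isLink := by
    intro e x y v w h h'
    have hx : x ∈ ({v, w} : Set J) := by
      rw [← h'.2, h.2]
      exact Set.mem_insert x {y}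
    simpa using hx
  left_mem_of_isLink := fun _ _ _ _ => Set.mem_univ _

/-! ### The edge zeta function of a loopless graph -/

section Zeta

variable {V E : Type*} (G : Graph V E)

/-- An edge of `G` together with one of its two directions. -/
structure DirectedEdge where
  source : V
  edge : E
  target : V
  isLink : G.IsLink edge source target

variable {G}

/-- A nonempty sequence of directed edges is a cycle if each one terminates where the next one
begins and the last one terminates where the first one begins. -/
def IsCycle (Γ : List (DirectedEdge G)) : Prop :=
  Γ.IsChain (fun d d' => d.target = d'.source) ∧
    ∃ h : Γ ≠ [], (Γ.getLast h).target = (Γ.head h).source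

/-- No edge is followed by itself (in either direction). -/
def IsBacktrackless (Γ : List (DirectedEdge G)) : Prop :=
  Γ.IsChain (fun d d' => d.edge ≠ d'.edge)

/-- The first edge and the last edge are different. -/
def IsTailless (Γ : List (DirectedEdge G)) : Prop :=
  ∀ h : Γ ≠ [], (Γ.head h).edge ≠ (Γ.getLast h).edge

/-- `Γ` is not obtained by following some cycle `r ≥ 2` times. -/
def IsPrimitive (Γ : List (DirectedEdge G)) : Prop :=
  ¬ ∃ (Θ : List (DirectedEdge G)) (r : ℕ),
    IsCycle Θ ∧ 2 ≤ r ∧ Γ = (List.replicate r Θ).flatten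

variable (G)

/-- The set `A(G)` of equivalence classes of backtrackless, tailless, primitive cycles.
Two cycles are equivalent if they differ by a cyclic shift; `Cycle` is the type of lists up
to cyclic shifts. -/
def primeCycles : Set (Cycle (DirectedEdge G)) :=
  {γ | ∃ Γ : List (DirectedEdge G), (Γ : Cycle (DirectedEdge G)) = γ ∧
    IsCycle Γ ∧ IsBacktrackless Γ ∧ IsTailless Γ ∧ IsPrimitive Γ}

variable {G}

/-- The monomial `g(Γ)`, the product of the indeterminates of the edges of `Γ`. -/
noncomputable def cycleMonomial (γ : Cycle (DirectedEdge G)) : MvPowerSeries E ℤ :=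
  (γ.toMultiset.map fun d => MvPowerSeries.X d.edge).prod

/-- The factor `(1 - g(Γ))⁻¹`. -/
noncomputable def eulerFactor (γ : Cycle (DirectedEdge G)) : MvPowerSeries E ℤ :=
  MvPowerSeries.invOfUnit (1 - cycleMonomial γ) 1

variable (G)

/-- The edge zeta function, the infinite product of the factors `(1 - g(Γ))⁻¹` over `A(G)`, taken
with respect to coefficientwise convergence in `ℤ⟦u_e : e ∈ E⟧`. -/
noncomputable def edgeZeta : MvPowerSeries E ℤ :=
  ∏' γ : primeCycles G, eulerFactor (γ : Cycle (DirectedEdge G))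

end Zeta

end CycleCode

/-!
Expanding the Euler factors as geometric series shows that the coefficient of `u ^ p` in
`edgeZeta G` is nonzero exactly when `p` is a sum of exponents of prime cycles. For the normal
graph, this condition and that of being an unscaled pseudo-codeword are both equivalent to a local
one: at every check `j`, the sum of `p` over the bits at `j` is even and no bit contributes more
than half of it.

The local condition is additive. It is necessary because it holds for each passage of a
backtrackless cycle through `j` and for the values of a codeword around each vertex of a cover over
`j`. Conversely, it allows the `p i` copies of the bits `i` at `j` to be paired so that no bit is
paired with a copy of itself. For the zeta function, take both directions of `p i` copies of each
edge `i` and let `r` be the reversal and `τ` the pairing at the source. The orbits of `τ * r` are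
backtrackless closed walks, and `r` matches them in pairs of a walk and its reverse, so choosing one
walk from each pair uses every edge `i` exactly `p i` times. For the cover, take `M` copies of every
node, set the first `p i` copies of each bit `i` to one, and join paired copies to the same copy
of `j`.
-/

namespace CycleCode

/-! ### Products of geometric series -/

section GeometricSeries

open MvPowerSeries

variable {σ ι R : Type*}

theorem coeff_prod_nonneg [CommSemiring R] [PartialOrder R] [IsOrderedRing R]
    {f : ι → MvPowerSeries σ R} {s : Finset ι} (hf : ∀ i ∈ s, ∀ p, 0 ≤ coeff p (f i))
    (p : σ →₀ ℕ) : 0 ≤ coeff p (∏ i ∈ s, f i) := by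
  classical
  refine Finset.prod_induction f (fun g => ∀ p, 0 ≤ coeff p g) (fun g h hg hh p => ?_)
    (fun p => ?_) hf p
  · rw [coeff_mul]
    exact Finset.sum_nonneg fun x _ => mul_nonneg (hg _) (hh _)
  · rw [coeff_one]
    split_ifs <;> simp

theorem one_le_coeff_prod [CommSemiring R] [PartialOrder R] [IsOrderedRing R]
    {f : ι → MvPowerSeries σ R} {s : Finset ι} (hf : ∀ i ∈ s, ∀ p, 0 ≤ coeff p (f i))
    {q : ι → σ →₀ ℕ} (hq : ∀ i ∈ s, 1 ≤ coeff (q i) (f i)) :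
    1 ≤ coeff (∑ i ∈ s, q i) (∏ i ∈ s, f i) := by
  classical
  induction s using Finset.induction_on with
  | empty => simp
  | insert i s hi ih =>
    simp only [Finset.forall_mem_insert] at hf hq
    have hs : 1 ≤ coeff (∑ i ∈ s, q i) (∏ i ∈ s, f i) := ih hf.2 hq.2
    rw [Finset.prod_insert hi, Finset.sum_insert hi, coeff_mul]
    refine (one_le_mul_of_one_le_of_one_le hq.1 hs).trans ?_
    exact Finset.single_le_sum (f := fun x => coeff x.1 (f i) * coeff x.2 (∏ i ∈ s, f i))
      (a := (q i, ∑ i ∈ s, q i)) (fun x _ => mul_nonneg (hf.1 _) (coeff_prod_nonneg hf.2 _))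
      (Finset.HasAntidiagonal.mem_antidiagonal.2 rfl)

theorem mem_of_coeff_prod_ne_zero [CommSemiring R] {f : ι → MvPowerSeries σ R} {s : Finset ι}
    {A : AddSubmonoid (σ →₀ ℕ)} (hf : ∀ i ∈ s, ∀ p, coeff p (f i) ≠ 0 → p ∈ A)
    {p : σ →₀ ℕ} (hp : coeff p (∏ i ∈ s, f i) ≠ 0) : p ∈ A := by
  classical
  refine Finset.prod_induction f (fun g => ∀ p, coeff p g ≠ 0 → p ∈ A) (fun g h hg hh p hp => ?_)
    (fun p hp => ?_) hf p hp
  · rw [coeff_mul] at hp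
    obtain ⟨x, hx, hne⟩ := Finset.exists_ne_zero_of_sum_ne_zero hp
    rw [← Finset.HasAntidiagonal.mem_antidiagonal.1 hx]
    exact add_mem (hg _ (left_ne_zero_of_mul hne)) (hh _ (right_ne_zero_of_mul hne))
  · rw [coeff_one] at hp
    exact (ite_ne_right_iff.1 hp).1 ▸ zero_mem A

open Classical in
/-- The geometric series `∑ₖ u ^ (k • w)`, where equal terms are counted only once: for `w ≠ 0`
this is the inverse of `1 - u ^ w`, and for `w = 0` it is `1`. -/
noncomputable def geomSeries (R : Type*) [CommRing R] (w : σ →₀ ℕ) : MvPowerSeries σ R :=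
  fun p => if p ∈ AddSubmonoid.multiples w then 1 else 0

open Classical in
theorem coeff_geomSeries [CommRing R] (w p : σ →₀ ℕ) :
    coeff p (geomSeries R w) = if p ∈ AddSubmonoid.multiples w then 1 else 0 :=
  rfl

theorem mem_multiples_iff_tsub_mem {w p : σ →₀ ℕ} (hp : p ≠ 0) :
    p ∈ AddSubmonoid.multiples w ↔ w ≤ p ∧ p - w ∈ AddSubmonoid.multiples w := by
  constructor
  · rintro ⟨k, rfl⟩
    obtain ⟨k, rfl⟩ := Nat.exists_eq_succ_of_ne_zero (n := k) (by rintro rfl; simp at hp)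
    exact ⟨by simp [succ_nsmul], by simpa [succ_nsmul] using ⟨k, rfl⟩⟩
  · rintro ⟨hle, h⟩
    rw [← tsub_add_cancel_of_le hle]
    exact add_mem h (AddSubmonoid.mem_multiples w)

theorem geomSeries_eq_one_add [CommRing R] {w : σ →₀ ℕ} (hw : w ≠ 0) :
    geomSeries R w = 1 + monomial w 1 * geomSeries R w := by
  classical
  ext p
  rw [map_add, coeff_monomial_mul, coeff_one, coeff_geomSeries, coeff_geomSeries]
  obtain rfl | hp := eq_or_ne p 0
  · simp [hw]
  · simp [hp, mem_multiples_iff_tsub_mem hp, ite_and]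

theorem invOfUnit_one_sub_monomial [CommRing R] {w : σ →₀ ℕ} (hw : w ≠ 0) :
    invOfUnit (1 - monomial w (1 : R)) 1 = geomSeries R w := by
  classical
  have hconst : constantCoeff (1 - monomial w (1 : R)) = ((1 : Rˣ) : R) := by
    rw [map_sub, ← coeff_zero_eq_constantCoeff_apply (monomial w (1 : R)),
      coeff_monomial_ne hw.symm]
    simp
  refine left_inv_eq_right_inv (invOfUnit_mul _ 1 hconst) ?_
  linear_combination geomSeries_eq_one_add (R := R) hw

theorem multipliable_geomSeries [CommRing R] [TopologicalSpace R] [IsTopologicalRing R]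
    {w : ι → σ →₀ ℕ} (hw : ∀ i, w i ≠ 0) (hfin : ∀ p, {i | w i ≤ p}.Finite) :
    Multipliable fun i => geomSeries R (w i) := by
  classical
  rw [funext fun i => geomSeries_eq_one_add (R := R) (hw i)]
  refine multipliable_one_add_of_summable_prod ?_
  refine WithPiTopology.summable_iff_summable_coeff.mpr fun p => summable_of_hasFiniteSupport ?_
  refine (hfin p).toFinset.powerset.finite_toSet.subset fun s hs => ?_
  have hle : ∑ i ∈ s, w i ≤ p := by
    rw [Function.mem_support, Finset.prod_mul_distrib, prod_monomial, Finset.prod_const_one,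
      coeff_monomial_mul] at hs
    exact (ite_ne_right_iff.1 hs).1
  simp only [Finset.coe_powerset, Set.mem_preimage, Set.mem_powerset_iff, Set.Finite.coe_toFinset]
  exact fun i hi => (Finset.single_le_sum (fun _ _ => zero_le) hi).trans hle

theorem coeff_tprod_geomSeries_ne_zero_iff [CommRing R] [PartialOrder R] [IsStrictOrderedRing R]
    [TopologicalSpace R] [IsTopologicalRing R] [OrderClosedTopology R] {w : ι → σ →₀ ℕ}
    (hw : ∀ i, w i ≠ 0) (hfin : ∀ p, {i | w i ≤ p}.Finite) (p : σ →₀ ℕ) :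
    coeff p (∏' i, geomSeries R (w i)) ≠ 0 ↔ p ∈ AddSubmonoid.closure (Set.range w) := by
  classical
  have hlim : Filter.Tendsto (fun s : Finset ι => coeff p (∏ i ∈ s, geomSeries R (w i)))
      Filter.atTop (nhds (coeff p (∏' i, geomSeries R (w i)))) :=
    ((WithPiTopology.continuous_coeff R p).tendsto _).comp
      (multipliable_geomSeries hw hfin).hasProd
  refine ⟨fun h => ?_, fun hp => ?_⟩
  · obtain ⟨s, hs⟩ := (hlim.eventually_ne h).exists
    refine mem_of_coeff_prod_ne_zero (fun i _ q hq => ?_) hs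
    rw [coeff_geomSeries] at hq
    exact AddSubmonoid.multiples_le.2 (AddSubmonoid.subset_closure (Set.mem_range_self i))
      (ite_ne_right_iff.1 hq).1
  · obtain ⟨k, rfl⟩ := AddSubmonoid.mem_closure_range_iff.1 hp
    have hge : 1 ≤ coeff (k.sum fun i n => n • w i) (∏' i, geomSeries R (w i)) := by
      refine ge_of_tendsto hlim (Filter.eventually_atTop.2 ⟨k.support, fun s hs => ?_⟩)
      rw [Finsupp.sum_of_support_subset k hs _ (by simp)]
      refine one_le_coeff_prod (fun i _ q => ?_) fun i _ => ?_
      · rw [coeff_geomSeries]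
        split_ifs <;> simp
      · rw [coeff_geomSeries, if_pos ⟨k i, rfl⟩]
    exact (zero_lt_one.trans_le hge).ne'

end GeometricSeries

/-! ### Exponents of prime cycles -/

section PrimeExponents

variable {V E : Type*} {G : Graph V E}

attribute [ext] DirectedEdge

/-- The same edge, traversed in the opposite direction. -/
def DirectedEdge.reverse (d : DirectedEdge G) : DirectedEdge G :=
  ⟨d.target, d.edge, d.source, d.isLink.symm⟩

theorem DirectedEdge.edge_eq_iff {d d' : DirectedEdge G} :
    d'.edge = d.edge ↔ d' = d ∨ d' = d.reverse := by
  refine ⟨fun h => ?_, by rintro (rfl | rfl) <;> rfl⟩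
  have hlink : G.IsLink d.edge d'.source d'.target := h ▸ d'.isLink
  obtain ⟨hs, ht⟩ | ⟨hs, ht⟩ := hlink.eq_and_eq_or_eq_and_eq d.isLink
  · exact Or.inl (DirectedEdge.ext hs h ht)
  · exact Or.inr (DirectedEdge.ext hs h ht)

theorem finite_setOf_edge_eq (e : E) : {d : DirectedEdge G | d.edge = e}.Finite := by
  obtain h | ⟨d, rfl⟩ := {d : DirectedEdge G | d.edge = e}.eq_empty_or_nonempty
  · simp [h]
  · exact (Set.toFinite {d, d.reverse}).subset fun d' hd' => DirectedEdge.edge_eq_iff.1 hd'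

/-- The exponent vector of the monomial `g(γ)`: it counts how often `γ` uses each edge. -/
noncomputable def cycleExponent (γ : Cycle (DirectedEdge G)) : E →₀ ℕ :=
  (γ.toMultiset.map fun d => Finsupp.single d.edge 1).sum

theorem cycleExponent_coe (Γ : List (DirectedEdge G)) :
    cycleExponent (Γ : Cycle (DirectedEdge G)) = (Γ.map fun d => Finsupp.single d.edge 1).sum := by
  simp [cycleExponent]

theorem degree_cycleExponent (Γ : List (DirectedEdge G)) :
    (cycleExponent (Γ : Cycle (DirectedEdge G))).degree = Γ.length := by
  simp [cycleExponent_coe, map_list_sum, Function.comp_def]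

theorem cycleExponent_flatten_replicate (r : ℕ) (Γ : List (DirectedEdge G)) :
    cycleExponent ((List.replicate r Γ).flatten : Cycle (DirectedEdge G)) =
      r • cycleExponent (Γ : Cycle (DirectedEdge G)) := by
  simp [cycleExponent_coe, List.sum_flatten]

theorem mem_support_cycleExponent {Γ : List (DirectedEdge G)} {d : DirectedEdge G} (hd : d ∈ Γ) :
    d.edge ∈ (cycleExponent (Γ : Cycle (DirectedEdge G))).support := by
  have hle : Finsupp.single d.edge 1 ≤ cycleExponent (Γ : Cycle (DirectedEdge G)) := by
    rw [cycleExponent_coe]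
    exact List.single_le_sum (fun _ _ => zero_le) _ (List.mem_map_of_mem hd)
  exact Finsupp.support_mono hle (by simp)

theorem cycleMonomial_eq_monomial (γ : Cycle (DirectedEdge G)) :
    cycleMonomial γ = MvPowerSeries.monomial (cycleExponent γ) 1 := by
  rw [cycleMonomial, cycleExponent]
  induction γ.toMultiset using Multiset.induction_on with
  | empty => simp [MvPowerSeries.monomial_zero_eq_C_apply]
  | cons d s ih =>
    rw [Multiset.map_cons, Multiset.prod_cons, ih, Multiset.map_cons, Multiset.sum_cons,
      MvPowerSeries.X, MvPowerSeries.monomial_mul_monomial, one_mul]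

theorem cycleExponent_ne_zero {γ : Cycle (DirectedEdge G)} (hγ : γ ∈ primeCycles G) :
    cycleExponent γ ≠ 0 := by
  obtain ⟨Γ, rfl, ⟨-, hne, -⟩, -⟩ := hγ
  rwa [Ne, ← Finsupp.degree_eq_zero_iff, degree_cycleExponent, List.length_eq_zero_iff]

theorem eulerFactor_eq_geomSeries {γ : Cycle (DirectedEdge G)} (hγ : γ ∈ primeCycles G) :
    eulerFactor γ = geomSeries ℤ (cycleExponent γ) := by
  rw [eulerFactor, cycleMonomial_eq_monomial,
    invOfUnit_one_sub_monomial (cycleExponent_ne_zero hγ)]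

theorem finite_setOf_cycleExponent_le (p : E →₀ ℕ) :
    {γ : Cycle (DirectedEdge G) | cycleExponent γ ≤ p}.Finite := by
  set S := {d : DirectedEdge G | d.edge ∈ p.support}
  have hS : S.Finite := p.support.finite_toSet.preimage' fun e _ => finite_setOf_edge_eq e
  have : Finite S := hS
  refine ((List.finite_length_le S p.degree).image
    fun Γ => ((Γ.map Subtype.val : List (DirectedEdge G)) : Cycle (DirectedEdge G))).subset ?_
  rintro ⟨Γ⟩ (hΓ : cycleExponent (Γ : Cycle (DirectedEdge G)) ≤ p)
  lift Γ to List S using fun d hd => Finsupp.support_mono hΓ (mem_support_cycleExponent hd)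
  refine ⟨Γ, ?_, rfl⟩
  simpa [degree_cycleExponent] using Finsupp.degree_mono hΓ

theorem finite_setOf_primeCycle_cycleExponent_le (p : E →₀ ℕ) :
    {γ : primeCycles G | cycleExponent (γ : Cycle (DirectedEdge G)) ≤ p}.Finite :=
  (finite_setOf_cycleExponent_le p).preimage Subtype.val_injective.injOn

theorem multipliable_eulerFactor (G : Graph V E) :
    Multipliable fun γ : primeCycles G => eulerFactor (γ : Cycle (DirectedEdge G)) := by
  simp only [eulerFactor_eq_geomSeries (Subtype.coe_prop _)]
  exact multipliable_geomSeries (fun γ => cycleExponent_ne_zero γ.2)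
    finite_setOf_primeCycle_cycleExponent_le

/-- The additive monoid generated by the exponent vectors of the prime cycles. -/
noncomputable def primeExponents (G : Graph V E) : AddSubmonoid (E →₀ ℕ) :=
  AddSubmonoid.closure
    (Set.range fun γ : primeCycles G => cycleExponent (γ : Cycle (DirectedEdge G)))

theorem coeff_edgeZeta_ne_zero_iff (G : Graph V E) (p : E →₀ ℕ) :
    MvPowerSeries.coeff p (edgeZeta G) ≠ 0 ↔ p ∈ primeExponents G := by
  simp only [edgeZeta, eulerFactor_eq_geomSeries (Subtype.coe_prop _)]
  exact coeff_tprod_geomSeries_ne_zero_iff (fun γ : primeCycles G => cycleExponent_ne_zero γ.2)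
    finite_setOf_primeCycle_cycleExponent_le p

/-- The directed edge `d'` may follow `d` in a backtrackless walk. -/
def Follows (d d' : DirectedEdge G) : Prop :=
  d.target = d'.source ∧ d.edge ≠ d'.edge

theorem chain_follows_iff {Γ : List (DirectedEdge G)} (hΓ : Γ ≠ []) :
    Cycle.Chain Follows (Γ : Cycle (DirectedEdge G)) ↔
      IsCycle Γ ∧ IsBacktrackless Γ ∧ IsTailless Γ := by
  have hand : Γ.IsChain Follows ↔
      Γ.IsChain (fun d d' => d.target = d'.source) ∧ Γ.IsChain fun d d' => d.edge ≠ d'.edge := by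
    simp only [List.isChain_iff_getElem, Follows]
    grind
  obtain ⟨d, Γ, rfl⟩ := List.exists_cons_of_ne_nil hΓ
  rw [Cycle.chain_ne_nil _ hΓ, List.isChain_cons_cons, hand]
  simp only [IsCycle, IsBacktrackless, IsTailless, Follows, List.head_cons]
  grind

theorem chain_of_chain_flatten_replicate {α : Type*} {R : α → α → Prop} {l : List α} {r : ℕ}
    (hr : r ≠ 0) (h : Cycle.Chain R ((List.replicate r l).flatten : Cycle α)) :
    Cycle.Chain R (l : Cycle α) := by
  obtain ⟨r, rfl⟩ := Nat.exists_eq_succ_of_ne_zero hr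
  cases l with
  | nil => exact Cycle.Chain.nil R
  | cons a l =>
    simp only [Nat.succ_eq_add_one, List.replicate_succ, List.flatten_cons, List.cons_append,
      Cycle.chain_coe_cons] at h ⊢
    cases r with
    | zero => simpa using h
    | succ r => exact h.prefix ⟨l ++ ((List.replicate r (a :: l)).flatten ++ [a]), by
        simp [List.replicate_succ]⟩

theorem cycleExponent_mem_primeExponents {γ : Cycle (DirectedEdge G)} (hγ : γ.Chain Follows) :
    cycleExponent γ ∈ primeExponents G := by
  obtain ⟨Γ, rfl⟩ : ∃ Γ : List (DirectedEdge G), (Γ : Cycle (DirectedEdge G)) = γ :=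
    Quotient.exists_rep γ
  induction hn : Γ.length using Nat.strong_induction_on generalizing Γ with
  | _ n ih =>
    obtain rfl | hΓ := eq_or_ne Γ []
    · simp [cycleExponent]
    by_cases hprim : IsPrimitive Γ
    · obtain ⟨hcyc, hback, htail⟩ := (chain_follows_iff hΓ).1 hγ
      exact AddSubmonoid.subset_closure ⟨⟨_, Γ, rfl, hcyc, hback, htail, hprim⟩, rfl⟩
    · obtain ⟨Θ, r, ⟨-, hΘ, -⟩, hr, rfl⟩ := not_not.1 hprim
      rw [cycleExponent_flatten_replicate]
      refine nsmul_mem (ih Θ.length ?_ Θ (chain_of_chain_flatten_replicate (by omega) hγ) rfl) r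
      have hpos : 0 < Θ.length := List.length_pos_of_ne_nil hΘ
      rw [← hn, List.length_flatten, List.map_replicate, List.sum_replicate, smul_eq_mul]
      nlinarith

end PrimeExponents

/-! ### Even points of a fundamental cone -/

section Cone

variable {ι : Type*}

/-- The even nonnegative integer points of the fundamental cone of a single parity check that
involves the bits in `s`: the sum over `s` is even and no entry exceeds the sum of the others. -/
def evenFundamentalCone (s : Finset ι) : AddSubmonoid (ι → ℕ) where
  carrier := {p | Even (∑ i ∈ s, p i) ∧ ∀ i ∈ s, 2 * p i ≤ ∑ i ∈ s, p i}
  zero_mem' := by simp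
  add_mem' := by
    rintro p q ⟨hp, hp'⟩ ⟨hq, hq'⟩
    simp only [Set.mem_ofPred_eq, Pi.add_apply, Finset.sum_add_distrib]
    exact ⟨hp.add hq, fun i hi => by linarith [hp' i hi, hq' i hi]⟩

theorem mem_evenFundamentalCone {s : Finset ι} {p : ι → ℕ} :
    p ∈ evenFundamentalCone s ↔ Even (∑ i ∈ s, p i) ∧ ∀ i ∈ s, 2 * p i ≤ ∑ i ∈ s, p i :=
  Iff.rfl

theorem mem_evenFundamentalCone_congr {s : Finset ι} {p q : ι → ℕ} (h : ∀ i ∈ s, p i = q i) :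
    p ∈ evenFundamentalCone s ↔ q ∈ evenFundamentalCone s := by
  rw [mem_evenFundamentalCone, mem_evenFundamentalCone, Finset.sum_congr rfl h]
  exact and_congr_right' (forall₂_congr fun i hi => by rw [h i hi])

theorem mem_evenFundamentalCone_of_le_one {s : Finset ι} {p : ι → ℕ} (heven : Even (∑ i ∈ s, p i))
    (hp : ∀ i ∈ s, p i ≤ 1) : p ∈ evenFundamentalCone s := by
  refine ⟨heven, fun i hi => ?_⟩
  have hle : p i ≤ ∑ i ∈ s, p i := Finset.single_le_sum (fun _ _ => zero_le) hi
  have := hp i hi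
  obtain ⟨m, hm⟩ := heven
  omega

theorem single_add_single_mem_evenFundamentalCone [DecidableEq ι] {s : Finset ι} {a b : ι}
    (ha : a ∈ s) (hb : b ∈ s) (hab : a ≠ b) :
    Pi.single a 1 + Pi.single b 1 ∈ evenFundamentalCone s := by
  refine mem_evenFundamentalCone_of_le_one ?_ fun i _ => ?_
  · simp [Finset.sum_add_distrib, Finset.sum_pi_single', ha, hb]
  · simp only [Pi.add_apply, Pi.single_apply]
    grind

/-- Sort the elements by colour and pair the positions that agree modulo `m`: two elements of one
colour at such positions would have the `m - 1` elements between them in the same colour. -/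
theorem exists_pairing {D K : Type*} [Finite D] (c : D → K) {m : ℕ} (hD : Nat.card D = 2 * m)
    (hc : ∀ k, Nat.card {d // c d = k} ≤ m) :
    ∃ e : D ≃ Fin 2 × Fin m, ∀ x y, c x = c y → (e x).2 = (e y).2 → x = y := by
  let : LinearOrder K := IsWellOrder.linearOrder WellOrderingRel
  let f : Fin (2 * m) ≃ D := (Finite.equivFinOfCardEq hD).symm
  let g : Fin (2 * m) ≃ D := (Tuple.sort (c ∘ f)).trans f
  have hmono : Monotone (c ∘ g) := Tuple.monotone_sort (c ∘ f)
  have hlt : ∀ a b : Fin (2 * m), c (g a) = c (g b) → (b : ℕ) < a + m := by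
    intro a b hab
    have hclass : ∀ i ∈ Finset.Icc a b, c (g i) = c (g b) := fun i hi =>
      le_antisymm (hmono (Finset.mem_Icc.1 hi).2) (hab ▸ hmono (Finset.mem_Icc.1 hi).1)
    let between : Finset.Icc a b → {d // c d = c (g b)} := fun i => ⟨g i, hclass i.1 i.2⟩
    have hinj : Function.Injective between := fun i j hij =>
      Subtype.ext (g.injective (congrArg Subtype.val hij))
    have hcard := (Nat.card_le_card_of_injective between hinj).trans (hc _)
    rw [Nat.card_eq_fintype_card, Fintype.card_coe, Fin.card_Icc] at hcard
    omega
  refine ⟨g.symm.trans finProdFinEquiv.symm, fun x y hxy h => ?_⟩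
  obtain ⟨a, rfl⟩ := g.surjective x
  obtain ⟨b, rfl⟩ := g.surjective y
  have hmod : (a : ℕ) ≡ b [MOD m] := by simpa [Nat.ModEq] using congrArg Fin.val h
  have hab := hlt a b hxy
  have hba := hlt b a hxy.symm
  rw [Fin.ext (hmod.eq_of_abs_lt (abs_lt.2 ⟨by omega, by omega⟩))]

theorem exists_involutive_ne {D K : Type*} [Finite D] (c : D → K) (heven : Even (Nat.card D))
    (hc : ∀ k, 2 * Nat.card {d // c d = k} ≤ Nat.card D) :
    ∃ τ : D → D, Function.Involutive τ ∧ ∀ d, c (τ d) ≠ c d := by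
  obtain ⟨m, hm⟩ := heven
  obtain ⟨e, he⟩ := exists_pairing c (hm.trans (two_mul m).symm) fun k => by
    have := hc k
    omega
  refine ⟨fun d => e.symm ((e d).1.rev, (e d).2), fun d => by simp, fun d h => ?_⟩
  have hfix : e.symm ((e d).1.rev, (e d).2) = d := he _ _ h (by simp)
  have hrev : (e d).1.rev = (e d).1 := congrArg Prod.fst ((Equiv.symm_apply_eq e).1 hfix)
  have hne : ∀ b : Fin 2, b.rev ≠ b := by decide
  exact hne _ hrev

theorem exists_involutive_fiberwise_ne {D V K : Type*} [Finite D] (s : D → V) (c : D → K)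
    (heven : ∀ v, Even (Nat.card {d // s d = v}))
    (hc : ∀ v k, 2 * Nat.card {d // s d = v ∧ c d = k} ≤ Nat.card {d // s d = v}) :
    ∃ τ : D → D, Function.Involutive τ ∧ ∀ d, s (τ d) = s d ∧ c (τ d) ≠ c d := by
  have hfiber : ∀ v, ∃ τ : {d // s d = v} → {d // s d = v},
      Function.Involutive τ ∧ ∀ d, c (τ d) ≠ c d := fun v =>
    exists_involutive_ne (fun d : {d // s d = v} => c d) (heven v) fun k => by
      rw [Nat.card_congr (Equiv.subtypeSubtypeEquivSubtypeInter (fun d => s d = v) (c · = k))]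
      exact hc v k
  choose τ hinv hne using hfiber
  have hval : ∀ v (x : {d // s d = v}), (τ (s x) ⟨x, rfl⟩ : D) = τ v x := by
    rintro _ ⟨d, rfl⟩
    rfl
  refine ⟨fun d => τ (s d) ⟨d, rfl⟩, fun d => ?_, fun d => ⟨(τ (s d) ⟨d, rfl⟩).2, hne _ _⟩⟩
  exact (hval _ _).trans (congrArg Subtype.val (hinv (s d) ⟨d, rfl⟩))

end Cone

/-! ### Pairs of involutions -/

section Involutions

variable {D M : Type*} {r τ : Equiv.Perm D}

theorem semiconjBy_mul_inv_of_involutive (hr : Function.Involutive r)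
    (hτ : Function.Involutive τ) : SemiconjBy r (τ * r) (τ * r)⁻¹ := by
  have hr' : r⁻¹ = r := inv_eq_of_mul_eq_one_right (Equiv.ext hr)
  have hτ' : τ⁻¹ = τ := inv_eq_of_mul_eq_one_right (Equiv.ext hτ)
  rw [SemiconjBy, mul_inv_rev, hr', hτ', mul_assoc]

/-- If `r d` were `(τ * r) ^ n d`, then `r` or `τ` would fix the midpoint between `d` and `r d`. -/
theorem not_sameCycle_apply_of_involutive (hr : Function.Involutive r)
    (hτ : Function.Involutive τ) (hr' : ∀ d, r d ≠ d) (hτ' : ∀ d, τ d ≠ d) (d : D) :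
    ¬ (τ * r).SameCycle d (r d) := by
  set f := τ * r
  have hconj : ∀ k : ℤ, r ((f ^ k) d) = (f ^ (-k)) (r d) := fun k => by
    rw [zpow_neg, ← inv_zpow]
    exact Equiv.congr_fun ((semiconjBy_mul_inv_of_involutive hr hτ).zpow_right k) d
  rintro ⟨n, hn⟩
  have hmid : ∀ k : ℤ, r ((f ^ k) d) = (f ^ (n - k)) d := fun k => by
    rw [hconj, ← hn, ← Equiv.Perm.mul_apply, ← zpow_add, neg_add_eq_sub]
  obtain ⟨k, rfl | rfl⟩ := Int.even_or_odd' n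
  · exact hr' _ ((hmid k).trans (by ring_nf))
  · refine hτ' (r ((f ^ k) d)) ?_
    calc τ (r ((f ^ k) d)) = (f ^ (1 + k)) d := by rw [zpow_one_add]; rfl
      _ = r ((f ^ k) d) := by rw [hmid]; ring_nf

theorem exists_sum_eq_two_nsmul_sum {Q : Type*} [Fintype Q] [AddCommMonoid M] {r : Q → Q}
    (hr : Function.Involutive r) (hr' : ∀ q, r q ≠ q) {g : Q → M} (hg : ∀ q, g (r q) = g q) :
    ∃ s : Finset Q, ∑ q, g q = 2 • ∑ q ∈ s, g q := by
  classical
  let : LinearOrder Q := IsWellOrder.linearOrder WellOrderingRel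
  refine ⟨Finset.univ.filter fun q => q < r q, ?_⟩
  have hcompl : ∑ q with ¬ q < r q, g q = ∑ q with q < r q, g q := by
    refine Finset.sum_nbij' r r (fun q hq => ?_) (fun q hq => ?_) (fun q _ => hr q)
      (fun q _ => hr q) fun q _ => (hg q).symm
    · simpa [hr q] using (hr' q).lt_of_le (by simpa using hq)
    · simpa [hr q] using (Finset.mem_filter.1 hq).2.le
  rw [← Finset.sum_filter_add_sum_filter_not _ (fun q => q < r q), hcompl, two_nsmul]

open Classical in
theorem exists_sum_eq_two_nsmul_of_sameCycle [Fintype D] [AddCommMonoid M] {A : AddSubmonoid M}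
    (hr : Function.Involutive r) (hτ : Function.Involutive τ) (hr' : ∀ d, r d ≠ d)
    (hτ' : ∀ d, τ d ≠ d) {w : D → M} (hw : ∀ d, w (r d) = w d)
    (hA : ∀ d, ∑ x with (τ * r).SameCycle d x, w x ∈ A) :
    ∃ q ∈ A, ∑ d, w d = 2 • q := by
  let S := Equiv.Perm.SameCycle.setoid (τ * r)
  have hmap : ∀ x y, S x y → S (r x) (r y) := fun x y h => by
    have := h.conj (g := r)
    rwa [(semiconjBy_mul_inv_of_involutive hr hτ).eq, mul_inv_cancel_right,
      Equiv.Perm.sameCycle_inv] at this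
  let R : Quotient S → Quotient S := Quotient.map r hmap
  let g : Quotient S → M := fun q => ∑ x with ⟦x⟧ = q, w x
  have hR : Function.Involutive R := by
    rintro ⟨d⟩
    exact congrArg _ (hr d)
  have hR' : ∀ q, R q ≠ q := by
    rintro ⟨d⟩ h
    exact not_sameCycle_apply_of_involutive hr hτ hr' hτ' d (Quotient.exact h).symm
  have hgR : ∀ q, g (R q) = g q := fun q =>
    (Finset.sum_nbij' r r (fun x hx => by simpa [R] using congrArg R (Finset.mem_filter.1 hx).2)
      (fun x hx => by
        have := congrArg R (Finset.mem_filter.1 hx).2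
        rw [hR] at this
        simpa [R] using this) (fun x _ => hr x) (fun x _ => hr x) fun x _ => (hw x).symm).symm
  have hgA : ∀ q, g q ∈ A := by
    rintro ⟨d⟩
    convert hA d using 3 with x
    exact Quotient.eq.trans Equiv.Perm.sameCycle_comm
  obtain ⟨s, hs⟩ := exists_sum_eq_two_nsmul_sum hR hR' hgR
  exact ⟨_, sum_mem fun q _ => hgA q, (Finset.sum_fiberwise _ _ _).symm.trans hs⟩

end Involutions

/-! ### Prime exponents of loopless graphs -/

section Chains

variable {α M : Type*} {R : α → α → Prop}

theorem rel_of_isChain_append_singleton {l : List α} {a b : α} (h : (a :: (l ++ [b])).IsChain R) :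
    Multiset.Rel R ↑(a :: l) ↑(l ++ [b]) := by
  induction l generalizing a with
  | nil => exact .cons (by simpa using h) .zero
  | cons x l ih =>
    rw [List.cons_append, List.isChain_cons_cons] at h
    exact .cons h.1 (ih h.2)

theorem rel_toMultiset_of_chain {γ : Cycle α} (h : γ.Chain R) :
    Multiset.Rel R γ.toMultiset γ.toMultiset := by
  induction γ with
  | nil => exact .zero
  | cons a l =>
    have hrel := rel_of_isChain_append_singleton ((Cycle.chain_coe_cons R a l).1 h)
    rwa [Multiset.coe_eq_coe.2 (List.perm_append_singleton a l)] at hrel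

theorem sum_add_sum_mem_of_rel [AddCommMonoid M] {A : AddSubmonoid M} {f g : α → M}
    (hfg : ∀ x y, R x y → f x + g y ∈ A) {s t : Multiset α} (h : Multiset.Rel R s t) :
    (s.map f).sum + (t.map g).sum ∈ A := by
  induction h with
  | zero => simp
  | cons hxy _ ih =>
    simp only [Multiset.map_cons, Multiset.sum_cons]
    rw [add_add_add_comm]
    exact add_mem (hfg _ _ hxy) ih

theorem chain_periodicOrbit {f : α → α} {x : α} (hx : x ∈ Function.periodicPts f) :
    (Function.periodicOrbit f x).Chain fun a b => f a = b :=
  (Function.periodicOrbit_chain' _ hx).2 fun n => (Function.iterate_succ_apply' f n x).symm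

open Classical in
theorem sum_sameCycle_eq_sum_periodicOrbit [Fintype α] [AddCommMonoid M] (f : Equiv.Perm α) (x : α)
    (w : α → M) :
    ∑ y with f.SameCycle x y, w y = ((Function.periodicOrbit f x).toMultiset.map w).sum := by
  have hx : x ∈ Function.periodicPts f := f.injective.mem_periodicPts x
  have hmem : ∀ y, y ∈ Function.periodicOrbit f x ↔ f.SameCycle x y := fun y => by
    simp only [Function.mem_periodicOrbit_iff hx, Equiv.Perm.iterate_eq_pow]
    exact ⟨fun ⟨n, hn⟩ => ⟨n, hn⟩, fun h => h.exists_nat_pow_eq⟩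
  have hnodup : (Function.periodicOrbit f x).Nodup := Function.nodup_periodicOrbit
  revert hmem hnodup
  generalize Function.periodicOrbit f x = γ
  induction γ using Quotient.inductionOn' with
  | h l =>
    intro hmem hnodup
    have : ({y | f.SameCycle x y} : Finset α) = l.toFinset := by
      ext y
      simpa using (hmem y).symm
    rw [this]
    exact List.sum_toFinset w hnodup

end Chains

section Loopless

variable {V E : Type*} {G : Graph V E}

theorem cycleExponent_apply (γ : Cycle (DirectedEdge G)) (e : E) :
    cycleExponent γ e = (γ.toMultiset.map fun d => Finsupp.single d.edge 1 e).sum := by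
  rw [cycleExponent, ← Finsupp.applyAddHom_apply, map_multiset_sum, Multiset.map_map]
  rfl

theorem mem_edgeSet_of_mem_primeExponents {p : E →₀ ℕ} (hp : p ∈ primeExponents G) {e : E}
    (he : p e ≠ 0) : e ∈ G.edgeSet := by
  revert he
  contrapose!
  intro he
  induction hp using AddSubmonoid.closure_induction with
  | mem p hp =>
    obtain ⟨γ, rfl⟩ := hp
    simp only [cycleExponent_apply]
    refine Multiset.sum_eq_zero fun n hn => ?_
    obtain ⟨d, -, rfl⟩ := Multiset.mem_map.1 hn
    exact Finsupp.single_eq_of_ne fun h => he (h ▸ d.isLink.edge_mem)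
  | zero => rfl
  | add p q _ _ hp hq => simp [hp, hq]

open Classical in
theorem DirectedEdge.single_edge_apply [G.Loopless] (d : DirectedEdge G) {e : E} {v : V}
    (he : G.Inc e v) :
    Finsupp.single d.edge 1 e =
      ((if d.target = v then Pi.single d.edge 1 else 0) +
        (if d.source = v then Pi.single d.edge 1 else 0) : E → ℕ) e := by
  obtain rfl | hne := eq_or_ne e d.edge
  · have hloop : d.source ≠ d.target := d.isLink.ne
    have hend : v = d.source ∨ v = d.target := he.eq_or_eq_of_isLink d.isLink
    obtain rfl | rfl := hend <;> simp [hloop, hloop.symm]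
  · split_ifs <;> simp [hne]

open Classical in
theorem mem_evenFundamentalCone_of_mem_primeExponents [Fintype E] [G.Loopless] {p : E →₀ ℕ}
    (hp : p ∈ primeExponents G) (v : V) : ⇑p ∈ evenFundamentalCone {e | G.Inc e v} := by
  induction hp using AddSubmonoid.closure_induction with
  | zero => exact zero_mem _
  | add p q _ _ hp hq => exact add_mem hp hq
  | mem p hp =>
    obtain ⟨⟨γ, Γ, rfl, hcyc, hback, htail, -⟩, rfl⟩ := hp
    have hchain : Cycle.Chain Follows (Γ : Cycle (DirectedEdge G)) :=
      (chain_follows_iff hcyc.2.1).2 ⟨hcyc, hback, htail⟩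
    have hmem := sum_add_sum_mem_of_rel (A := evenFundamentalCone {e | G.Inc e v})
      (f := fun d => if d.target = v then Pi.single d.edge 1 else 0)
      (g := fun d => if d.source = v then Pi.single d.edge 1 else 0) ?_
      (rel_toMultiset_of_chain hchain)
    · refine (mem_evenFundamentalCone_congr fun e he => ?_).2 hmem
      rw [cycleExponent_apply, ← Multiset.sum_map_add, Pi.multiset_sum_apply, Multiset.map_map]
      exact congrArg Multiset.sum
        (Multiset.map_congr rfl fun d _ => d.single_edge_apply (by simpa using he))
    · rintro d d' ⟨hdd', hne⟩
      rw [← hdd']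
      split_ifs with hv
      · subst hv
        exact single_add_single_mem_evenFundamentalCone (by simpa using d.isLink.inc_right)
          (by simpa [hdd'] using d'.isLink.inc_left) hne
      · exact zero_mem _

theorem card_subtype_sigma_fin {α : Type*} [Fintype α] (n : α → ℕ) (P : α → Prop)
    [DecidablePred P] : Nat.card {x : Σ a, Fin (n a) // P x.1} = ∑ a with P a, n a := by
  rw [Nat.card_congr (Equiv.subtypeSigmaEquiv _ P), Nat.card_sigma]
  simp only [Nat.card_fin]
  exact (Finset.sum_subtype _ (by simp) n).symm

theorem finite_directedEdge [Finite E] : Finite (DirectedEdge G) :=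
  Set.finite_univ_iff.1 (Set.finite_univ.preimage' (f := DirectedEdge.edge)
    fun e _ => finite_setOf_edge_eq e)

open Classical in
theorem sum_source_eq [Fintype E] [Fintype (DirectedEdge G)] [G.Loopless] {M : Type*}
    [AddCommMonoid M] (v : V) (h : E → M) :
    ∑ d : DirectedEdge G with d.source = v, h d.edge = ∑ e with G.Inc e v, h e := by
  refine Finset.sum_nbij DirectedEdge.edge (fun d hd => ?_) (fun d hd d' hd' hdd' => ?_)
    (fun e he => ?_) fun _ _ => rfl
  · simp only [Finset.mem_filter_univ] at hd ⊢
    exact hd ▸ d.isLink.inc_left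
  · simp only [Finset.coe_filter_univ, Set.mem_ofPred_eq] at hd hd'
    obtain rfl | rfl := DirectedEdge.edge_eq_iff.1 hdd'
    · rfl
    · exact absurd (hd'.trans hd.symm) d'.isLink.ne
  · obtain ⟨w, hw⟩ : G.Inc e v := by simpa using he
    exact ⟨⟨v, e, w, hw⟩, by simp⟩

open Classical in
theorem sum_edge_eq [Fintype (DirectedEdge G)] [G.Loopless] {e : E} (he : e ∈ G.edgeSet)
    {M : Type*} [AddCommMonoid M] (h : E → M) :
    ∑ d : DirectedEdge G with d.edge = e, h d.edge = 2 • h e := by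
  obtain ⟨v, w, hvw⟩ := G.exists_isLink_of_mem_edgeSet he
  have hne : (⟨v, e, w, hvw⟩ : DirectedEdge G) ≠ DirectedEdge.reverse ⟨v, e, w, hvw⟩ :=
    fun hrev => hvw.ne (congrArg DirectedEdge.source hrev)
  have hdir : ({d | d.edge = e} : Finset (DirectedEdge G)) =
      {⟨v, e, w, hvw⟩, DirectedEdge.reverse ⟨v, e, w, hvw⟩} := by
    ext d
    simpa using DirectedEdge.edge_eq_iff (d := ⟨v, e, w, hvw⟩) (d' := d)
  rw [hdir, Finset.sum_pair hne, two_nsmul]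
  rfl

open Classical in
theorem exists_involutive_source_eq_edge_ne [Fintype E] [G.Loopless] {p : E → ℕ}
    (hp : ∀ v, p ∈ evenFundamentalCone {e | G.Inc e v}) :
    ∃ τ : (Σ d : DirectedEdge G, Fin (p d.edge)) → Σ d : DirectedEdge G, Fin (p d.edge),
      Function.Involutive τ ∧ ∀ x, (τ x).1.source = x.1.source ∧ (τ x).1.edge ≠ x.1.edge := by
  have := finite_directedEdge (G := G)
  have := Fintype.ofFinite (DirectedEdge G)
  have hcard : ∀ v, Nat.card {x : Σ d : DirectedEdge G, Fin (p d.edge) // x.1.source = v} =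
      ∑ e with G.Inc e v, p e := fun v =>
    (card_subtype_sigma_fin _ fun d : DirectedEdge G => d.source = v).trans (sum_source_eq v p)
  refine exists_involutive_fiberwise_ne (D := Σ d : DirectedEdge G, Fin (p d.edge))
    (fun x => x.1.source) (fun x => x.1.edge) (fun v => hcard v ▸ (hp v).1) fun v e => ?_
  rw [hcard, card_subtype_sigma_fin _ fun d : DirectedEdge G => d.source = v ∧ d.edge = e,
    ← Finset.filter_filter, Finset.sum_filter,
    sum_source_eq v fun e' => if e' = e then p e' else 0, Finset.sum_ite_eq']
  split_ifs with he
  · exact (hp v).2 e he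
  · simp

theorem sum_single_edge [Fintype (DirectedEdge G)] [G.Loopless] {p : E →₀ ℕ}
    (hE : ∀ e, p e ≠ 0 → e ∈ G.edgeSet) :
    ∑ x : Σ d : DirectedEdge G, Fin (p d.edge), Finsupp.single x.1.edge 1 = 2 • p := by
  classical
  ext e
  have hsum : (∑ x : Σ d : DirectedEdge G, Fin (p d.edge), Finsupp.single x.1.edge 1) e =
      ∑ d : DirectedEdge G with d.edge = e, p d.edge := by
    simp [Fintype.sum_sigma, Finsupp.finsetSum_apply, Finsupp.single_apply, Finset.sum_filter]
  rw [hsum, Finsupp.smul_apply]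
  by_cases he : e ∈ G.edgeSet
  · exact sum_edge_eq he p
  · rw [not_not.1 (mt (hE e) he)]
    refine Finset.sum_eq_zero fun d hd => ?_
    rw [(Finset.mem_filter.1 hd).2, not_not.1 (mt (hE e) he)]

open Classical in
theorem sum_sameCycle_mem_primeExponents {D : Type*} [Fintype D] {δ : D → DirectedEdge G}
    {f : Equiv.Perm D} (hf : ∀ x, Follows (δ x) (δ (f x))) (x : D) :
    ∑ y with f.SameCycle x y, Finsupp.single (δ y).edge 1 ∈ primeExponents G := by
  have hchain : (Function.periodicOrbit f x).Chain fun y z => Follows (δ y) (δ z) :=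
    Cycle.Chain.imp (fun y z (hy : f y = z) => hy ▸ hf y)
      (chain_periodicOrbit (f.injective.mem_periodicPts x))
  have hexp : cycleExponent ((Function.periodicOrbit f x).map δ) =
      ((Function.periodicOrbit f x).toMultiset.map fun y => Finsupp.single (δ y).edge 1).sum := by
    rw [cycleExponent]
    induction Function.periodicOrbit f x using Quotient.inductionOn'
    simp [Function.comp_def]
  rw [sum_sameCycle_eq_sum_periodicOrbit, ← hexp]
  exact cycleExponent_mem_primeExponents ((Cycle.chain_map δ).2 hchain)

open Classical in
theorem mem_primeExponents_of_mem_evenFundamentalCone [Fintype E] [G.Loopless] {p : E →₀ ℕ}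
    (hE : ∀ e, p e ≠ 0 → e ∈ G.edgeSet)
    (hp : ∀ v, ⇑p ∈ evenFundamentalCone {e | G.Inc e v}) : p ∈ primeExponents G := by
  have := finite_directedEdge (G := G)
  have := Fintype.ofFinite (DirectedEdge G)
  obtain ⟨τ, hτ, hτs⟩ := exists_involutive_source_eq_edge_ne hp
  let r : (Σ d : DirectedEdge G, Fin (p d.edge)) → Σ d : DirectedEdge G, Fin (p d.edge) :=
    fun x => ⟨x.1.reverse, x.2⟩
  have hr : Function.Involutive r := fun _ => rfl
  obtain ⟨q, hq, hsum⟩ := exists_sum_eq_two_nsmul_of_sameCycle (A := primeExponents G)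
    (r := hr.toPerm) (τ := hτ.toPerm) (w := fun x => Finsupp.single x.1.edge 1) hr hτ
    (fun x hx => x.1.isLink.ne (congrArg (fun y => y.1.source) hx).symm)
    (fun x hx => (hτs x).2 (by rw [← hτ.coe_toPerm, hx])) (fun _ => rfl)
    (sum_sameCycle_mem_primeExponents (f := hτ.toPerm * hr.toPerm) (δ := Sigma.fst)
      fun y => ⟨(hτs (r y)).1.symm, (hτs (r y)).2.symm⟩)
  rw [sum_single_edge hE] at hsum
  rwa [nsmul_right_injective two_ne_zero hsum]

open Classical in
theorem mem_primeExponents_iff [Fintype E] [G.Loopless] {p : E →₀ ℕ} :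
    p ∈ primeExponents G ↔ (∀ e, p e ≠ 0 → e ∈ G.edgeSet) ∧
      ∀ v, ⇑p ∈ evenFundamentalCone {e | G.Inc e v} :=
  ⟨fun hp => ⟨fun _ => mem_edgeSet_of_mem_primeExponents hp,
    mem_evenFundamentalCone_of_mem_primeExponents hp⟩,
    fun hp => mem_primeExponents_of_mem_evenFundamentalCone hp.1 hp.2⟩

end Loopless

section NormalGraph

variable {J I : Type*} {H : Matrix J I (ZMod 2)}

instance : (normalGraph H).Loopless := ⟨fun _ _ h => h.1 rfl⟩

theorem IsCycleCode.ncard_eq_two (hH : IsCycleCode H) (i : I) : {j | H j i = 1}.ncard = 2 := by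
  have hset : (tannerGraph H).neighborSet (Sum.inl i) = Sum.inr '' {j | H j i = 1} := by
    ext x
    obtain i' | j := x <;> simp [tannerGraph]
  rw [← Set.ncard_image_of_injective _ Sum.inr_injective, ← hset]
  exact hH i

theorem IsCycleCode.inc_normalGraph_iff (hH : IsCycleCode H) {i : I} {j : J} :
    (normalGraph H).Inc i j ↔ H j i = 1 := by
  refine ⟨fun ⟨j', _, h⟩ => h.symm.subset (Set.mem_insert j {j'}), fun h => ?_⟩
  obtain ⟨x, y, hxy, hs⟩ := Set.ncard_eq_two.1 (hH.ncard_eq_two i)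
  obtain rfl | rfl : j = x ∨ j = y := hs.subset h
  · exact ⟨y, hxy, hs⟩
  · exact ⟨x, hxy.symm, hs.trans (Set.pair_comm x j)⟩

theorem IsCycleCode.mem_edgeSet_normalGraph (hH : IsCycleCode H) (i : I) :
    i ∈ (normalGraph H).edgeSet := by
  obtain ⟨x, y, hxy, hs⟩ := Set.ncard_eq_two.1 (hH.ncard_eq_two i)
  exact ⟨x, y, hxy, hs⟩

theorem IsCycleCode.mem_primeExponents_normalGraph_iff [Fintype I] (hH : IsCycleCode H)
    {p : I →₀ ℕ} :
    p ∈ primeExponents (normalGraph H) ↔ ∀ j, ⇑p ∈ evenFundamentalCone {i | H j i = 1} := by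
  classical
  simp [mem_primeExponents_iff, hH.inc_normalGraph_iff, hH.mem_edgeSet_normalGraph]

end NormalGraph

/-! ### Pseudo-codewords of covers -/

section Codewords

variable {J I W : Type*} {H : Matrix J I (ZMod 2)} {Y : SimpleGraph W} {π : Y →g tannerGraph H}

open Classical in
/-- The configuration of a cover of a Tanner graph with support `S`. -/
noncomputable def bitIndicator (π : Y →g tannerGraph H) (S : Finset W) : BitNode π → ZMod 2 :=
  fun b => if (b : W) ∈ S then 1 else 0

theorem exists_eq_bitIndicator [Finite W] (c : BitNode π → ZMod 2) :
    ∃ S, c = bitIndicator π S := by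
  classical
  have := Fintype.ofFinite W
  refine ⟨({b | c b = 1} : Finset (BitNode π)).map (Function.Embedding.subtype _), ?_⟩
  ext b : 1
  have hbit : ∀ x : ZMod 2, x = if x = 1 then 1 else 0 := by decide
  rw [hbit (c b), bitIndicator]
  congr 1
  simpa using fun _ => b.2

open Classical in
theorem card_filter_bitNode [Fintype W] (π : Y →g tannerGraph H) {S : Finset W} {P : W → Prop}
    [DecidablePred P] (hP : ∀ w, P w → (π w).isLeft = true) :
    (S.filter P).card = (Finset.univ.filter fun b : BitNode π => P b ∧ (b : W) ∈ S).card := by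
  refine (Finset.card_nbij Subtype.val (fun b hb => ?_) Subtype.val_injective.injOn
    fun w hw => ?_).symm
  · simpa [and_comm] using hb
  · obtain ⟨hwS, hw⟩ := Finset.mem_filter.1 hw
    exact ⟨⟨w, hP w hw⟩, by simpa using ⟨hw, hwS⟩, rfl⟩

theorem isLeft_of_adj_of_isRight {w b : W} (hw : (π w).isRight = true) (hb : Y.Adj w b) :
    (π b).isLeft = true := by
  obtain ⟨j, hj⟩ := Sum.isRight_iff.1 hw
  have hadj := π.map_adj hb
  rw [hj] at hadj
  obtain ⟨i, -, h, -⟩ | ⟨i, -, -, h, -⟩ := hadj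
  · cases h
  · simp [h]

open Classical in
theorem bitIndicator_mem_binaryCode_iff [Fintype W] (S : Finset W) :
    bitIndicator π S ∈ binaryCode (coverMatrix π) ↔
      ∀ w, (π w).isRight = true → Even (S.filter fun b => Y.Adj w b).card := by
  rw [binaryCode, LinearMap.mem_ker, Matrix.mulVecLin_apply, funext_iff, Subtype.forall]
  refine forall₂_congr fun w hw => ?_
  rw [card_filter_bitNode π fun b => isLeft_of_adj_of_isRight hw, ← ZMod.natCast_eq_zero_iff_even,
    Finset.natCast_card_filter]
  simp only [Matrix.mulVec, dotProduct, coverMatrix, bitIndicator, Pi.zero_apply, ite_and, ite_mul,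
    one_mul, zero_mul]

open Classical in
theorem smul_pseudoCodeword_bitIndicator [Fintype W] {M : ℕ} (hM : M ≠ 0) (S : Finset W) (i : I) :
    ((M : ℚ) • pseudoCodeword π M (bitIndicator π S)) i =
      (S.filter fun b => π b = Sum.inl i).card := by
  have hM : (M : ℚ) ≠ 0 := Nat.cast_ne_zero.2 hM
  rw [card_filter_bitNode π fun b hb => Sum.isLeft_iff.2 ⟨i, hb⟩, ← Finset.filter_filter,
    Finset.natCast_card_filter, Pi.smul_apply, pseudoCodeword, smul_eq_mul, one_div,
    mul_inv_cancel_left₀ hM]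
  refine Finset.sum_congr rfl fun b _ => ?_
  rw [bitIndicator]
  split_ifs <;> rfl

open Classical in
theorem isUnscaledPseudoCodeword_iff_exists_support {p : I → ℕ} :
    IsUnscaledPseudoCodeword H (fun i => (p i : ℚ)) ↔
      ∃ (M : ℕ) (W : Type) (_ : Fintype W) (Y : SimpleGraph W) (π : Y →g tannerGraph H)
        (S : Finset W), 0 < M ∧ IsMCover π M ∧
          (∀ w, (π w).isRight = true → Even (S.filter fun b => Y.Adj w b).card) ∧
          ∀ i, p i = (S.filter fun b => π b = Sum.inl i).card := by
  constructor
  · rintro ⟨M, W, _, Y, π, hM, hπ, c, hc, hp⟩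
    obtain ⟨S, rfl⟩ := exists_eq_bitIndicator c
    exact ⟨M, W, inferInstance, Y, π, S, hM, hπ, (bitIndicator_mem_binaryCode_iff S).1 hc,
      fun i => Nat.cast_injective
        ((congrFun hp i).trans (smul_pseudoCodeword_bitIndicator hM.ne' S i))⟩
  · rintro ⟨M, W, _, Y, π, S, hM, hπ, hS, hp⟩
    exact ⟨M, W, inferInstance, Y, π, hM, hπ, bitIndicator π S,
      (bitIndicator_mem_binaryCode_iff S).2 hS, funext fun i =>
        (congrArg Nat.cast (hp i)).trans (smul_pseudoCodeword_bitIndicator hM.ne' S i).symm⟩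

end Codewords

section Necessity

variable {V W : Type*} {X : SimpleGraph V} {Y : SimpleGraph W} {π : Y →g X} {M : ℕ}

theorem IsMCover.existsUnique_adj (hπ : IsMCover π M) (w : W) {x : V} (hx : X.Adj (π w) x) :
    ∃! w', Y.Adj w w' ∧ π w' = x := by
  obtain ⟨w', hw', hw'x⟩ := (hπ.bijOn_neighborSet w).surjOn hx
  exact ⟨w', ⟨hw', hw'x⟩, fun y hy =>
    (hπ.bijOn_neighborSet w).injOn hy.1 hw' (hy.2.trans hw'x.symm)⟩

open Classical in
theorem IsMCover.card_fiber_eq_sum [Fintype W] [DecidableEq V] (hπ : IsMCover π M)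
    (S : Finset W) {x y : V} (hxy : X.Adj x y) :
    (S.filter fun b => π b = y).card =
      ∑ w with π w = x, (S.filter fun b => Y.Adj w b ∧ π b = y).card := by
  have hone : ∀ b ∈ S.filter fun b => π b = y,
      ((Finset.univ.filter fun w => π w = x).filter fun w => Y.Adj w b).card = 1 := by
    intro b hb
    obtain ⟨w, hw, huniq⟩ := hπ.existsUnique_adj b ((Finset.mem_filter.1 hb).2 ▸ hxy.symm)
    refine Finset.card_eq_one.2 ⟨w, Finset.eq_singleton_iff_unique_mem.2 ⟨?_, fun w' hw' => ?_⟩⟩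
    · simpa using ⟨hw.2, hw.1.symm⟩
    · simp only [Finset.mem_filter, Finset.mem_univ, true_and] at hw'
      exact huniq w' ⟨hw'.2.symm, hw'.1⟩
  rw [Finset.card_eq_sum_ones, ← Finset.sum_congr rfl hone]
  refine (Finset.sum_card_bipartiteAbove_eq_sum_card_bipartiteBelow Y.Adj).symm.trans
    (Finset.sum_congr rfl fun w _ => ?_)
  rw [Finset.bipartiteAbove, Finset.filter_filter]
  simp only [and_comm]

open Classical in
theorem IsMCover.card_filter_adj_le_one [DecidableEq V] (hπ : IsMCover π M) (S : Finset W)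
    (w : W) (x : V) :
    (S.filter fun b => Y.Adj w b ∧ π b = x).card ≤ 1 := by
  refine Finset.card_le_one.2 fun b hb b' hb' => ?_
  simp only [Finset.mem_filter] at hb hb'
  exact (hπ.bijOn_neighborSet w).injOn hb.2.1 hb'.2.1 (hb.2.2.trans hb'.2.2.symm)

end Necessity

section Tanner

variable {J I : Type*} {H : Matrix J I (ZMod 2)}

theorem tannerGraph_adj_inr_iff {j : J} {y : I ⊕ J} :
    (tannerGraph H).Adj (Sum.inr j) y ↔ ∃ i, H j i = 1 ∧ Sum.inl i = y := by
  obtain i | j' := y <;> simp [tannerGraph]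

open Classical in
theorem card_filter_adj_eq_sum [Fintype I] {W : Type*} {Y : SimpleGraph W}
    {π : Y →g tannerGraph H} (S : Finset W) {w : W} {j : J} (hw : π w = Sum.inr j) :
    (S.filter fun b => Y.Adj w b).card =
      ∑ i with H j i = 1, (S.filter fun b => Y.Adj w b ∧ π b = Sum.inl i).card := by
  rw [Finset.card_eq_sum_card_fiberwise (f := π)
    (t := (Finset.univ.filter fun i => H j i = 1).map Function.Embedding.inl), Finset.sum_map]
  · simp only [Finset.filter_filter, Function.Embedding.inl_apply]
  · intro b hb
    have hadj : (tannerGraph H).Adj (Sum.inr j) (π b) := hw ▸ π.map_adj (Finset.mem_filter.1 hb).2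
    simpa using tannerGraph_adj_inr_iff.1 hadj

theorem mem_evenFundamentalCone_of_isUnscaledPseudoCodeword [Fintype I] {p : I → ℕ}
    (hp : IsUnscaledPseudoCodeword H (fun i => (p i : ℚ))) (j : J) :
    p ∈ evenFundamentalCone {i | H j i = 1} := by
  classical
  obtain ⟨M, W, _, Y, π, S, -, hπ, hS, hp⟩ := isUnscaledPseudoCodeword_iff_exists_support.1 hp
  have hlocal : ∀ w, π w = Sum.inr j →
      (fun i => (S.filter fun b => Y.Adj w b ∧ π b = Sum.inl i).card) ∈
        evenFundamentalCone {i | H j i = 1} := fun w hw =>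
    mem_evenFundamentalCone_of_le_one (card_filter_adj_eq_sum S hw ▸ hS w (by simp [hw]))
      fun i _ => hπ.card_filter_adj_le_one S w _
  refine (mem_evenFundamentalCone_congr fun i hi => ?_).2
    (sum_mem fun w hw => hlocal w ((Finset.mem_filter_univ w).1 hw))
  rw [hp, Finset.sum_apply]
  exact hπ.card_fiber_eq_sum S (tannerGraph_adj_inr_iff.2 ⟨i, by simpa using hi, rfl⟩)

end Tanner

/-! ### Derived graphs of permutation voltages -/

section DerivedGraph

variable {V F : Type*} {X : SimpleGraph V} {σ : V → V → Equiv.Perm F}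

/-- The covering graph derived from a permutation voltage assignment `σ` on `X`: for every edge
`xy` of `X`, the copy `k` of `x` is joined to the copy `σ x y k` of `y`. -/
def derivedGraph (X : SimpleGraph V) (σ : V → V → Equiv.Perm F)
    (hσ : ∀ x y, σ y x = (σ x y)⁻¹) : SimpleGraph (V × F) where
  Adj a b := X.Adj a.1 b.1 ∧ σ a.1 b.1 a.2 = b.2
  symm := ⟨fun a b h => ⟨h.1.symm, by rw [hσ a.1, ← h.2]; exact Equiv.symm_apply_apply _ _⟩⟩
  loopless := ⟨fun a h => X.irrefl h.1⟩

/-- The covering projection of a derived graph. -/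
def derivedProj (hσ : ∀ x y, σ y x = (σ x y)⁻¹) : derivedGraph X σ hσ →g X where
  toFun := Prod.fst
  map_rel' h := h.1

theorem isMCover_derivedProj [Nonempty F] (hσ : ∀ x y, σ y x = (σ x y)⁻¹) :
    IsMCover (derivedProj (X := X) hσ) (Nat.card F) where
  surjective := Prod.fst_surjective
  bijOn_neighborSet a := by
    refine ⟨fun b hb => hb.1, fun b hb b' hb' (hbb' : b.1 = b'.1) => Prod.ext hbb' ?_, fun y hy =>
      ⟨(y, σ a.1 y a.2), ⟨hy, rfl⟩, rfl⟩⟩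
    rw [← hb.2, ← hb'.2, hbb']
  ncard_fiber x := by
    have hfiber : derivedProj (X := X) hσ ⁻¹' {x} = Set.range (Prod.mk x) := by
      ext ⟨y, k⟩
      simp [derivedProj, eq_comm]
    rw [hfiber, ← Set.image_univ, Set.ncard_image_of_injective _ (Prod.mk_right_injective x),
      Set.ncard_univ]

open Classical in
theorem card_filter_adj_derivedGraph [Fintype V] (hσ : ∀ x y, σ y x = (σ x y)⁻¹)
    (S : Finset (V × F)) (a : V × F) :
    (S.filter fun b => (derivedGraph X σ hσ).Adj a b).card =
      (Finset.univ.filter fun y => X.Adj a.1 y ∧ (y, σ a.1 y a.2) ∈ S).card := by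
  refine Finset.card_nbij Prod.fst ?_ ?_ ?_
  · intro b hb
    obtain ⟨hS, hadj, h⟩ := Finset.mem_filter.1 hb
    exact (Finset.mem_filter_univ _).2 ⟨hadj, by rwa [h]⟩
  · intro b hb b' hb' (hbb' : b.1 = b'.1)
    refine Prod.ext hbb' ?_
    rw [← (Finset.mem_filter.1 hb).2.2, ← (Finset.mem_filter.1 hb').2.2, hbb']
  · intro y hy
    obtain ⟨hadj, hS⟩ := (Finset.mem_filter_univ _).1 hy
    exact ⟨(y, σ a.1 y a.2), Finset.mem_filter.2 ⟨hS, hadj, rfl⟩, rfl⟩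

end DerivedGraph

section Sufficiency

theorem IsMCover.comp_iso {V W Z : Type*} {X : SimpleGraph V} {Y : SimpleGraph W}
    {Y' : SimpleGraph Z} {π : Y →g X} {M : ℕ} (hπ : IsMCover π M) (e : Y' ≃g Y) :
    IsMCover (π.comp e.toHom) M where
  surjective := hπ.surjective.comp e.surjective
  bijOn_neighborSet z := by
    refine (hπ.bijOn_neighborSet (e z)).comp ⟨fun w hw => e.map_adj_iff.2 hw, e.injective.injOn,
      fun w hw => ⟨e.symm w, ?_, e.apply_symm_apply w⟩⟩
    exact e.map_adj_iff.1 (by simpa using hw)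
  ncard_fiber x := by
    rw [← hπ.ncard_fiber x]
    exact Set.ncard_preimage_of_injective_subset_range (s := π ⁻¹' {x}) e.injective
      (by simp [e.surjective.range_eq])

variable {J I : Type*} {H : Matrix J I (ZMod 2)}

open Classical in
theorem IsMCover.isUnscaledPseudoCodeword {W : Type*} [Finite W] {Y : SimpleGraph W}
    {π : Y →g tannerGraph H} {M : ℕ} (hπ : IsMCover π M) (hM : 0 < M) {S : Finset W}
    (hS : ∀ w, (π w).isRight = true → Even (S.filter fun b => Y.Adj w b).card) :
    IsUnscaledPseudoCodeword H fun i => ((S.filter fun b => π b = Sum.inl i).card : ℚ) := by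
  let f : W ≃ Fin (Nat.card W) := Finite.equivFin W
  let e : Y.comap f.symm ≃g Y := SimpleGraph.Iso.comap f.symm Y
  refine isUnscaledPseudoCodeword_iff_exists_support.2
    ⟨M, _, inferInstance, _, π.comp e.toHom, S.map f.toEmbedding, hM, hπ.comp_iso e,
      fun w hw => ?_, fun i => ?_⟩
  · rw [Finset.filter_map, Finset.card_map]
    convert hS (f.symm w) hw using 4
    simp
  · rw [Finset.filter_map, Finset.card_map]
    congr 1
    ext b
    simp [e]

theorem exists_perm_val_lt_iff {n M : ℕ} {g : Fin n → Fin M} (hg : Function.Injective g) :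
    ∃ σ : Equiv.Perm (Fin M), ∀ t, (σ t : ℕ) < n ↔ ∃ a, g a = t := by
  have hn : n ≤ M := by simpa using Fintype.card_le_of_injective g hg
  obtain ⟨σ, hσ⟩ := Equiv.Perm.exists_extending_pair g (Fin.castLE hn) hg (Fin.castLE_injective hn)
  refine ⟨σ, fun t => ⟨fun ht => ⟨⟨σ t, ht⟩, σ.injective ?_⟩, ?_⟩⟩
  · exact hσ _
  · rintro ⟨a, rfl⟩
    simp [hσ]

theorem exists_pairing_of_mem_evenFundamentalCone {ι : Type*} {s : Finset ι} {p : ι → ℕ}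
    (hp : p ∈ evenFundamentalCone s) :
    ∃ m, m ≤ ∑ i ∈ s, p i ∧ ∃ e : (Σ i : s, Fin (p i)) ≃ Fin 2 × Fin m,
      ∀ i, Function.Injective fun a => (e ⟨i, a⟩).2 := by
  classical
  obtain ⟨⟨m, hm⟩, hle⟩ := hp
  have hcard : Nat.card (Σ i : s, Fin (p i)) = 2 * m := by
    rw [Nat.card_sigma]
    simp only [Nat.card_fin]
    rw [Finset.sum_coe_sort s p, hm, two_mul]
  obtain ⟨e, he⟩ := exists_pairing Sigma.fst hcard fun i => by
    rw [card_subtype_sigma_fin _ (· = i), Finset.sum_filter, Finset.sum_ite_eq' Finset.univ i,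
      if_pos (Finset.mem_univ i)]
    have := hle i i.2
    omega
  exact ⟨m, by omega, e, fun i a b hab => by
    simpa using he ⟨i, a⟩ ⟨i, b⟩ rfl hab⟩

theorem exists_perm_even_card {ι : Type*} {s : Finset ι} {p : ι → ℕ} {M : ℕ}
    (hp : p ∈ evenFundamentalCone s) (hM : ∑ i ∈ s, p i ≤ M) :
    ∃ σ : ι → Equiv.Perm (Fin M), ∀ t, Even (s.filter fun i => (σ i t : ℕ) < p i).card := by
  obtain ⟨m, hm, e, he⟩ := exists_pairing_of_mem_evenFundamentalCone hp
  let g (x : Σ i : s, Fin (p i)) : Fin M := Fin.castLE (hm.trans hM) (e x).2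
  have hg (i : s) : Function.Injective fun a => g ⟨i, a⟩ := (Fin.castLE_injective _).comp (he i)
  have hσ (i : ι) : ∃ σ : Equiv.Perm (Fin M),
      ∀ hi : i ∈ s, ∀ t, (σ t : ℕ) < p i ↔ ∃ a, g ⟨⟨i, hi⟩, a⟩ = t := by
    by_cases hi : i ∈ s
    · exact (exists_perm_val_lt_iff (hg ⟨i, hi⟩)).imp fun _ h _ => h
    · exact ⟨1, fun h => absurd h hi⟩
  choose σ hσ using hσ
  refine ⟨σ, fun t => ?_⟩
  have hcard : (s.filter fun i => (σ i t : ℕ) < p i).card =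
      (Finset.univ.filter fun x => g x = t).card := by
    refine (Finset.card_nbij (fun x => (x.1 : ι)) ?_ ?_ ?_).symm
    · rintro ⟨i, a⟩ hx
      have hx : g ⟨i, a⟩ = t := (Finset.mem_filter_univ (p := fun x => g x = t) _).1 hx
      exact Finset.mem_filter.2 ⟨i.2, (hσ i i.2 t).2 ⟨a, hx⟩⟩
    · rintro ⟨i, a⟩ hx ⟨i', b⟩ hy hxy
      obtain rfl : i = i' := Subtype.ext hxy
      simp only [Finset.coe_filter_univ, Set.mem_ofPred_eq] at hx hy
      rw [hg i (hx.trans hy.symm)]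
    · intro i hi
      obtain ⟨his, hi⟩ := Finset.mem_filter.1 hi
      obtain ⟨a, ha⟩ := (hσ i his t).1 hi
      exact ⟨⟨⟨i, his⟩, a⟩, (Finset.mem_filter_univ _).2 ha, rfl⟩
  have hprod : (Finset.univ.filter fun x => g x = t).map e.toEmbedding =
      Finset.univ ×ˢ Finset.univ.filter fun k => Fin.castLE (hm.trans hM) k = t := by
    ext y
    simp [g]
  rw [hcard, ← Finset.card_map e.toEmbedding, hprod, Finset.card_product, Finset.card_fin]
  exact even_two_mul _

/-- The voltages on a Tanner graph that join copy `k` of the check `j` to copy `τ j i k` of the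
bit `i`. -/
def tannerVoltage {F : Type*} (τ : J → I → Equiv.Perm F) : I ⊕ J → I ⊕ J → Equiv.Perm F
  | .inr j, .inl i => τ j i
  | .inl i, .inr j => (τ j i)⁻¹
  | _, _ => 1

theorem tannerVoltage_symm {F : Type*} (τ : J → I → Equiv.Perm F) :
    ∀ x y, tannerVoltage τ y x = (tannerVoltage τ x y)⁻¹
  | .inr _, .inl _ => rfl
  | .inl _, .inr _ => (inv_inv _).symm
  | .inl _, .inl _ => inv_one.symm
  | .inr _, .inr _ => inv_one.symm

theorem isUnscaledPseudoCodeword_of_mem_evenFundamentalCone [Finite J] [Fintype I] {p : I → ℕ}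
    (hp : ∀ j, p ∈ evenFundamentalCone {i | H j i = 1}) :
    IsUnscaledPseudoCodeword H fun i => (p i : ℚ) := by
  classical
  have := Fintype.ofFinite J
  let M := ∑ i, p i + 1
  have hM (j : J) : ∑ i with H j i = 1, p i ≤ M :=
    (Finset.sum_le_sum_of_subset (Finset.subset_univ _)).trans (Nat.le_succ _)
  choose τ hτ using fun j => exists_perm_even_card (hp j) (hM j)
  let S : Finset ((I ⊕ J) × Fin M) := {b | ∃ i, b.1 = Sum.inl i ∧ (b.2 : ℕ) < p i}
  let π := derivedProj (X := tannerGraph H) (tannerVoltage_symm τ)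
  have hcard (i : I) : (S.filter fun b => π b = Sum.inl i).card = p i := by
    have hS : (S.filter fun b => π b = Sum.inl i) =
        ({t | (t : ℕ) < p i} : Finset (Fin M)).map (.sectR (Sum.inl i) _) := by
      ext ⟨x, t⟩
      simp only [S, π, derivedProj, RelHom.coeFn_mk, Finset.mem_filter, Finset.mem_univ, true_and,
        Finset.mem_map, Function.Embedding.sectR_apply, Prod.mk.injEq]
      constructor
      · rintro ⟨⟨i', rfl, h⟩, hi⟩
        exact ⟨t, Sum.inl_injective hi ▸ h, hi.symm, rfl⟩
      · rintro ⟨_, h, rfl, rfl⟩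
        exact ⟨⟨i, rfl, h⟩, rfl⟩
    rw [hS, Finset.card_map, Fin.card_filter_val_lt, min_eq_right]
    exact (Finset.single_le_sum (fun _ _ => zero_le) (Finset.mem_univ i)).trans (Nat.le_succ _)
  rw [← funext fun i => congrArg Nat.cast (hcard i)]
  refine (isMCover_derivedProj _).isUnscaledPseudoCodeword Nat.card_pos fun ⟨x, t⟩ hx => ?_
  obtain ⟨j, rfl⟩ : ∃ j, x = Sum.inr j := Sum.isRight_iff.1 hx
  rw [card_filter_adj_derivedGraph]
  convert hτ j t using 1
  rw [Finset.filter_filter, ← Finset.card_map (.inl : I ↪ I ⊕ J)]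
  congr 1
  ext y
  obtain i | j' := y
  · simp [S, tannerGraph_adj_inr_iff, tannerVoltage]
  · simp [S]

theorem isUnscaledPseudoCodeword_iff [Finite J] [Fintype I] {p : I → ℕ} :
    IsUnscaledPseudoCodeword H (fun i => (p i : ℚ)) ↔
      ∀ j, p ∈ evenFundamentalCone {i | H j i = 1} :=
  ⟨mem_evenFundamentalCone_of_isUnscaledPseudoCodeword,
    isUnscaledPseudoCodeword_of_mem_evenFundamentalCone⟩

end Sufficiency

end CycleCode

/-- The product defining the edge zeta function of the normal graph of a cycle code converges, and
a monomial occurs in it exactly when its exponent vector is an unscaled pseudo-codeword. -/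
theorem mainTheorem1 {J I : Type*} [Fintype J] [Fintype I] (H : Matrix J I (ZMod 2))
    (hH : CycleCode.IsCycleCode H) :
    Multipliable (fun γ : CycleCode.primeCycles (CycleCode.normalGraph H) =>
        CycleCode.eulerFactor (γ : Cycle (CycleCode.DirectedEdge (CycleCode.normalGraph H)))) ∧
      ∀ p : I →₀ ℕ,
        MvPowerSeries.coeff p (CycleCode.edgeZeta (CycleCode.normalGraph H)) ≠ 0 ↔
          CycleCode.IsUnscaledPseudoCodeword H (fun i => (p i : ℚ)) := by
  refine ⟨CycleCode.multipliable_eulerFactor _, fun p => ?_⟩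
  rw [CycleCode.coeff_edgeZeta_ne_zero_iff, hH.mem_primeExponents_normalGraph_iff,
    CycleCode.isUnscaledPseudoCodeword_iff]
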